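/- **Setting.** A problem instance is $P=(X,y,X_{\mathrm{val}},y_{\mathrm{val}})\in\mathbb R^{m\times p}\times\{\pm1\}^m\times\mathbb R^{m'\times p}\times\{\pm1\}^{m'}$. Let $l(\beta,(X,y))=\frac1m\sum_{i=1}^m\log(1+e^{-y_ix_i^\top\beta})$ and let $R(\beta)=\|\beta\|_1$ or $R(\beta)=\|\beta\|_2^2$. For $\lambda\in[\lambda_{\min},\lambda_{\max}]$ with $\lambda_{\min}>0$ put $\hat\beta_{(X,y)}(\lambda)\in\arg\min_{\beta\in\mathbb R^p}\, l(\beta,(X,y))+\lambda R(\beta)$ and let $h(\lambda,P)=l(\hat\beta_{(X,y)}(\lambda),(X_{\mathrm{val}},y_{\mathrm{val}}))$ be the validation loss. Fix constants $B$ and $\kappa>0$. Instances are *admissible* if all entries of $X$ and $X_{\mathrm{val}}$ are at most $B$ in absolute value and, in the case $R=\|\cdot\|_1$ only, the active columns of $X$ are uniformly linearly independent: for every $\lambda\in[\lambda_{\min},\lambda_{\max}]$ and every $\ell_1$-regularized minimizer $\hat\beta$, with $A=\{j:\hat\beta_j\ne0\}$, all eigenvalues of $\frac1mX_A^\top X_A$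 are at least $\kappa$. In each round $t=1,\dots,T$ the learner, knowing $T$, the admissible class, and the instances and actions of the rounds before $t$, draws $\lambda_t\in[\lambda_{\min},\lambda_{\max}]$ at random, while an adversary, who may be randomized and may react to the past instances and actions, presents an admissible $P_t$, conditionally independent of $\lambda_t$ given the past; then $P_t$ is revealed. The expected regret is $$R_T=\mathbb E\sum_{t=1}^T\bigl(h(\lambda_t,P_t)-h(\lambda^*,P_t)\bigr),\qquad \lambda^*\in\arg\min_{\lambda\in[\lambda_{\min},\lambda_{\max}]}\mathbb E\sum_{t=1}^Th(\lambda,P_t).$$ **Theorem.** For each of the two penalties there is a constant $C$ that depends only on $p,\lambda_{\min},B,\kappa$ such that for all $m,m'$, all $\lambda_{\max}$ and all $T$ with $(\lambda_{\max}-\lambda_{\min})T\ge2$ there is an online learner such that, against every adversary, the losses $h(\lambda_t,P_t)$ and $h(\lambda,P_t)$ are integrable, a minimizer $\lambda^*$ as above exists, and $$R_T\le C\sqrt{T\log\bigl((\lambda_{\max}-\lambda_{\min})T\bigr)}.$$ -/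

import Mathlib

open MeasureTheory ProbabilityTheory

noncomputable section

namespace RegularizedLogisticRegression

/-- A problem instance `(X, y, X_val, y_val)`: `m` training examples and `m'` validation examples
with `p` features and labels in `{1, -1}`. -/
abbrev Instance (m p m' : ℕ) : Type :=
  (Fin m → Fin p → ℝ) × (Fin m → ℤˣ) × (Fin m' → Fin p → ℝ) × (Fin m' → ℤˣ)

/-- The logistic loss `l(β, (X, y)) = (1/n) ∑ i, log (1 + exp (- y_i x_iᵀ β))`. -/
def logisticLoss {n p : ℕ} (β : Fin p → ℝ) (X : Fin n → Fin p → ℝ) (y : Fin n → ℤˣ) : ℝ :=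
  (1 / (n : ℝ)) * ∑ i, Real.log (1 + Real.exp (-(((y i : ℤ) : ℝ) * (X i ⬝ᵥ β))))

/-- The two kinds of regularization. -/
inductive Penalty : Type
  | l1 : Penalty
  | l2 : Penalty

/-- `R(β) = ‖β‖₁` or `R(β) = ‖β‖₂²`. -/
def Penalty.value {p : ℕ} : Penalty → (Fin p → ℝ) → ℝ
  | .l1, β => ∑ j, |β j|
  | .l2, β => ∑ j, β j ^ 2

/-- The regularized training objective `l(β, (X, y)) + lam * R(β)`. -/
def objective {n p : ℕ} (pen : Penalty) (X : Fin n → Fin p → ℝ) (y : Fin n → ℤˣ) (lam : ℝ)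
    (β : Fin p → ℝ) : ℝ :=
  logisticLoss β X y + lam * pen.value β

/-- `β` is a regularized logistic regression fit: a global minimizer of the objective. -/
def IsFit {n p : ℕ} (pen : Penalty) (X : Fin n → Fin p → ℝ) (y : Fin n → ℤˣ) (lam : ℝ)
    (β : Fin p → ℝ) : Prop :=
  IsMinOn (objective pen X y lam) Set.univ β

/-- The estimator `β̂_{(X, y)}(lam) = argmin_β l(β, (X, y)) + lam * R(β)`. -/
def estimator {n p : ℕ} (pen : Penalty) (X : Fin n → Fin p → ℝ) (y : Fin n → ℤˣ) (lam : ℝ) :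
    Fin p → ℝ :=
  Classical.epsilon (IsFit pen X y lam)

/-- The validation loss `h(lam, P) = l(β̂_{(X, y)}(lam), (X_val, y_val))`. -/
def validationLoss {m p m' : ℕ} (pen : Penalty) (lam : ℝ) (P : Instance m p m') : ℝ :=
  logisticLoss (estimator pen P.1 P.2.1 lam) P.2.2.1 P.2.2.2

/-- For every `lam ∈ Λ`, the Gram matrix `(1/n) X_Aᵀ X_A` of the columns active in an
`ℓ1`-regularized fit, `A = {j | β̂_j(lam) ≠ 0}`, has all its eigenvalues at least `κ`. -/
def ActiveGramBound {n p : ℕ} (κ : ℝ) (Λ : Set ℝ) (X : Fin n → Fin p → ℝ) (y : Fin n → ℤˣ) :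
    Prop :=
  ∀ lam ∈ Λ, ∀ β : Fin p → ℝ, IsFit Penalty.l1 X y lam β →
    ∀ v : Fin p → ℝ, (∀ j, β j = 0 → v j = 0) →
      κ * ∑ j, v j ^ 2 ≤ (1 / (n : ℝ)) * ∑ i, (X i ⬝ᵥ v) ^ 2

/-- The instances among which the adversary chooses: features in `[-B, B]` and, in the case of the
`ℓ1` penalty only, active columns that are uniformly linearly independent. -/
def admissible (pen : Penalty) (m p m' : ℕ) (B κ : ℝ) (Λ : Set ℝ) : Set (Instance m p m') :=
  {P | (∀ i j, |P.1 i j| ≤ B) ∧ (∀ i j, |P.2.2.1 i j| ≤ B) ∧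
    (pen = Penalty.l1 → ActiveGramBound κ Λ P.1 P.2.1)}

end RegularizedLogisticRegression

namespace OnlineLearning

/-- A (randomized) online learner with actions in `A` and full information about the instances
in `𝒳`: in round `t` it draws its action from a distribution that depends (measurably) on the
actions and instances of the rounds `0, …, t - 1`. -/
structure Learner (A 𝒳 : Type) [MeasurableSpace A] [MeasurableSpace 𝒳] where
  predict : (t : ℕ) → Kernel (Fin t → A × 𝒳) A
  markov : ∀ t, IsMarkovKernel (predict t)

/-- The actions and instances of the rounds before round `t`. -/
def history {Ω A 𝒳 : Type*} (act : ℕ → Ω → A) (inst : ℕ → Ω → 𝒳) (t : ℕ) (ω : Ω) :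
    Fin t → A × 𝒳 :=
  fun i => (act i ω, inst i ω)

/-- The processes `act` and `inst` on the probability space `(Ω, μ)` are a play of `T` rounds of
the learner against some (possibly randomized and adaptive) adversary: in round `t < T`, given the
history and the instance of round `t`, the action has the law `predict t history`. The law
of the instance given the history is arbitrary. -/
structure IsPlay {A 𝒳 : Type} [MeasurableSpace A] [MeasurableSpace 𝒳] (L : Learner A 𝒳) (T : ℕ)
    {Ω : Type*} [MeasurableSpace Ω] (μ : Measure Ω) (act : ℕ → Ω → A) (inst : ℕ → Ω → 𝒳) :
    Prop where
  measurable_act : ∀ t, Measurable (act t)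
  measurable_inst : ∀ t, Measurable (inst t)
  law : ∀ t < T,
    μ.map (fun ω => ((history act inst t ω, inst t ω), act t ω)) =
      (μ.map fun ω => (history act inst t ω, inst t ω)) ⊗ₘ (L.predict t).prodMkRight 𝒳

/-- The expected cumulative loss `𝔼 ∑_{t < T} loss a P_t` of a fixed action `a`. -/
def expectedLoss {A 𝒳 : Type} {Ω : Type*} [MeasurableSpace Ω] (μ : Measure Ω)
    (loss : A → 𝒳 → ℝ) (T : ℕ) (inst : ℕ → Ω → 𝒳) (a : A) : ℝ :=
  ∫ ω, ∑ t ∈ Finset.range T, loss a (inst t ω) ∂μ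

/-- The regret `𝔼 ∑_{t < T} (loss a_t P_t - loss a P_t)` with respect to a fixed action `a`. -/
def expectedRegret {A 𝒳 : Type} {Ω : Type*} [MeasurableSpace Ω] (μ : Measure Ω)
    (loss : A → 𝒳 → ℝ) (T : ℕ) (act : ℕ → Ω → A) (inst : ℕ → Ω → 𝒳) (a : A) : ℝ :=
  ∫ ω, ∑ t ∈ Finset.range T, (loss (act t ω) (inst t ω) - loss a (inst t ω)) ∂μ

end OnlineLearning

end

/-!
The regret bound combines a stability estimate for the regularized fit with exponential weights on
a grid of regularization parameters.

*Stability.* Let `β` and `β'` be fits at `lam` and `lam'`. Comparing the two objective values with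
those at the midpoint of `β` and `β'` shows that the gain from midpoint strong convexity is at most
`|lam - lam'| * |R(β) - R(β')|`, which is `O(|lam - lam'| * ‖β - β'‖)` because all fits lie in a
ball whose radius depends only on `lamMin` and `p`. For the `ℓ2` penalty the gain comes from the
penalty. For the `ℓ1` penalty it comes from the loss, whose scalar version is strongly convex on
bounded intervals, and it is at least a multiple of `‖β - β'‖²` as soon as the Gram bound applies to
`β - β'`, that is, as soon as the active set of one of the fits contains that of the other
(`fitModulus_mul_sum_sq_le`). This containment need not hold for arbitrary `lam` and `lam'`, but
suffices in two situations. At a single parameter, a suitable convex combination of two fits is a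
fit that is active wherever the two differ, so the fit is unique (`IsFit.unique`); with compactness,
it is then continuous in the parameter and in the instance (`continuous_estimator`). By this
continuity, coordinates active at `lam` stay active nearby, so the path is Lipschitz near each
`lam` with a uniform constant, and hence on the whole interval (`abs_validationLoss_sub_le`).

*Learning.* The validation loss is thus bounded, Lipschitz in the parameter, and measurable.
Exponential weights on a finite grid have regret `O(H √(T log N))` on every sequence of losses
(`sum_expWeights_le`), and the conditional law of the actions transfers this to the expected regret
against an adaptive adversary (`expectedRegret_hedge_le`). With about `(lamMax - lamMin) T` grid
points, rounding the best parameter to the grid costs `O(1)` in total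
(`exists_learner_of_lipschitz`).
-/

namespace RegularizedLogisticRegression

/-! ### The scalar logistic loss -/

lemma log_one_add_exp_neg_nonneg (a : ℝ) : 0 ≤ Real.log (1 + Real.exp (-a)) :=
  Real.log_nonneg (by linarith [Real.exp_pos (-a)])

lemma abs_log_one_add_exp_neg_sub_le (a b : ℝ) :
    |Real.log (1 + Real.exp (-a)) - Real.log (1 + Real.exp (-b))| ≤ |a - b| := by
  have key : ∀ a b : ℝ,
      Real.log (1 + Real.exp (-a)) ≤ |a - b| + Real.log (1 + Real.exp (-b)) := by
    intro a b
    have h1 : Real.exp (-a) ≤ Real.exp |a - b| * Real.exp (-b) := by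
      rw [← Real.exp_add]
      exact Real.exp_le_exp.2 (by linarith [neg_abs_le (a - b)])
    have h2 : 1 ≤ Real.exp |a - b| := Real.one_le_exp (abs_nonneg _)
    have hb := Real.exp_pos (-b)
    calc Real.log (1 + Real.exp (-a))
        ≤ Real.log (Real.exp |a - b| * (1 + Real.exp (-b))) :=
          Real.log_le_log (by linarith [Real.exp_pos (-a)]) (by linarith)
      _ = |a - b| + Real.log (1 + Real.exp (-b)) := by
          rw [Real.log_mul (Real.exp_pos _).ne' (by linarith), Real.log_exp]
  have h1 := key a b
  have h2 := key b a
  rw [abs_sub_comm b a] at h2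
  exact abs_le.2 ⟨by linarith, by linarith⟩

/-- A modulus of midpoint strong convexity of `a ↦ log (1 + exp (-a))` on `[-M, M]`. -/
noncomputable def logisticCurvature (M : ℝ) : ℝ :=
  Real.exp (-M) / (1 + Real.exp M) ^ 2 / 4 / (1 + M ^ 2)

lemma logisticCurvature_pos (M : ℝ) : 0 < logisticCurvature M := by
  unfold logisticCurvature
  positivity

lemma exp_neg_mul_sq_le_sq_exp_sub_exp {M x y : ℝ} (hx : -M ≤ x) (hy : -M ≤ y) :
    Real.exp (-(2 * M)) * (x - y) ^ 2 ≤ (Real.exp x - Real.exp y) ^ 2 := by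
  wlog hxy : y ≤ x generalizing x y
  · have := this hy hx (le_of_not_ge hxy)
    nlinarith
  have h1 : Real.exp (-M) * (x - y) ≤ Real.exp x - Real.exp y := by
    have e : Real.exp x = Real.exp y * Real.exp (x - y) := by
      rw [← Real.exp_add]; congr 1; ring
    have h2 := Real.add_one_le_exp (x - y)
    calc Real.exp (-M) * (x - y) ≤ Real.exp y * (x - y) :=
          mul_le_mul_of_nonneg_right (Real.exp_le_exp.2 hy) (by linarith)
      _ ≤ Real.exp y * (Real.exp (x - y) - 1) :=
          mul_le_mul_of_nonneg_left (by linarith) (Real.exp_pos y).le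
      _ = _ := by rw [e]; ring
  have e : Real.exp (-(2 * M)) = Real.exp (-M) ^ 2 := by
    rw [← Real.exp_nat_mul]; congr 1; push_cast; ring
  rw [e, ← mul_pow]
  exact pow_le_pow_left₀ (mul_nonneg (Real.exp_pos _).le (by linarith)) h1 2

/-- Midpoint strong convexity of the scalar logistic loss on bounded intervals. With `s` the
midpoint, `(1 + e⁻ᵃ) (1 + e⁻ᵇ) = (1 + e⁻ˢ)² + (e⁻ᵃᐟ² - e⁻ᵇᐟ²)²`, so the gap is the logarithm of
`1 + (e⁻ᵃᐟ² - e⁻ᵇᐟ²)² / (1 + e⁻ˢ)²`. -/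
lemma logistic_midpoint {M a b : ℝ} (ha : |a| ≤ M) (hb : |b| ≤ M) :
    2 * Real.log (1 + Real.exp (-((a + b) / 2))) + logisticCurvature M * (a - b) ^ 2 ≤
      Real.log (1 + Real.exp (-a)) + Real.log (1 + Real.exp (-b)) := by
  obtain ⟨ha1, ha2⟩ := abs_le.1 ha
  obtain ⟨hb1, hb2⟩ := abs_le.1 hb
  set u := Real.exp (-a / 2) with hu
  set w := Real.exp (-b / 2) with hw
  have hu0 : 0 < u := Real.exp_pos _
  have hw0 : 0 < w := Real.exp_pos _
  have eu : Real.exp (-a) = u ^ 2 := by rw [hu, ← Real.exp_nat_mul]; congr 1; push_cast; ring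
  have ew : Real.exp (-b) = w ^ 2 := by rw [hw, ← Real.exp_nat_mul]; congr 1; push_cast; ring
  have es : Real.exp (-((a + b) / 2)) = u * w := by
    rw [hu, hw, ← Real.exp_add]; congr 1; ring
  have huw : u * w ≤ Real.exp M := by rw [← es]; exact Real.exp_le_exp.2 (by linarith)
  have hd : Real.exp (-M) * ((a - b) ^ 2 / 4) ≤ (u - w) ^ 2 := by
    have := exp_neg_mul_sq_le_sq_exp_sub_exp (M := M / 2) (x := -a / 2) (y := -b / 2)
      (by linarith) (by linarith)
    rw [show -(2 * (M / 2)) = -M by ring, show (-a / 2 - -b / 2) ^ 2 = (a - b) ^ 2 / 4 by ring]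
      at this
    exact this
  set q := Real.exp (-M) / (1 + Real.exp M) ^ 2 with hq
  have hq0 : 0 < q := by positivity
  have hM : 0 ≤ M := (abs_nonneg a).trans ha
  have hq1 : q ≤ 1 := by
    rw [hq, div_le_one (by positivity)]
    have h1 : Real.exp (-M) ≤ 1 := Real.exp_le_one_iff.2 (by linarith)
    nlinarith [Real.exp_pos M]
  set D := (a - b) ^ 2 / 4 with hD
  have hD0 : 0 ≤ D := by positivity
  have hDM : D ≤ M ^ 2 := by
    have : |a - b| ≤ 2 * M := abs_le.2 ⟨by linarith, by linarith⟩
    have := pow_le_pow_left₀ (abs_nonneg _) this 2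
    rw [sq_abs] at this
    rw [hD]; linarith
  have hqD : q * D ≤ (u - w) ^ 2 / (1 + u * w) ^ 2 := by
    rw [hq, div_mul_eq_mul_div]
    gcongr
  have hpos : 0 < u * w := by positivity
  have hlog : Real.log (1 + q * D) ≤
      Real.log (1 + u ^ 2) + Real.log (1 + w ^ 2) - 2 * Real.log (1 + u * w) := by
    have e : Real.log (1 + u ^ 2) + Real.log (1 + w ^ 2) - 2 * Real.log (1 + u * w) =
        Real.log ((1 + u ^ 2) * (1 + w ^ 2) / (1 + u * w) ^ 2) := by
      rw [Real.log_div (by positivity) (by positivity), Real.log_mul (by positivity)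
        (by positivity), Real.log_pow]
      push_cast; ring
    rw [e]
    refine Real.log_le_log (by positivity) ?_
    have : (1 + u ^ 2) * (1 + w ^ 2) / (1 + u * w) ^ 2 = 1 + (u - w) ^ 2 / (1 + u * w) ^ 2 := by
      field_simp; ring
    rw [this]; linarith
  have hlow : logisticCurvature M * (a - b) ^ 2 ≤ Real.log (1 + q * D) := by
    have h1 := Real.one_sub_inv_le_log_of_pos (x := 1 + q * D) (by positivity)
    have h2 : 1 - (1 + q * D)⁻¹ = q * D / (1 + q * D) := by
      have : 0 < 1 + q * D := by positivity
      field_simp; ring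
    have h3 : logisticCurvature M * (a - b) ^ 2 = q * D / (1 + M ^ 2) := by
      unfold logisticCurvature
      rw [← hq, hD]; ring
    rw [h3]
    have h4 : q * D ≤ M ^ 2 := by nlinarith
    calc q * D / (1 + M ^ 2) ≤ q * D / (1 + q * D) := by gcongr
      _ ≤ _ := by rw [← h2]; exact h1
  rw [eu, ew, es]
  linarith

/-! ### The empirical loss -/

variable {n p : ℕ}

lemma abs_label (y : ℤˣ) : |((y : ℤ) : ℝ)| = 1 := by
  rcases Int.units_eq_one_or y with h | h <;> simp [h]

lemma abs_dotProduct_le {B : ℝ} {x v : Fin p → ℝ} (hx : ∀ j, |x j| ≤ B) :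
    |x ⬝ᵥ v| ≤ |B| * ∑ j, |v j| := by
  rw [dotProduct, Finset.mul_sum]
  refine (Finset.abs_sum_le_sum_abs _ _).trans (Finset.sum_le_sum fun j _ => ?_)
  rw [abs_mul]
  exact mul_le_mul_of_nonneg_right ((hx j).trans (le_abs_self B)) (abs_nonneg _)

/-- An average of terms bounded by `c` is at most `c`, also for an empty sample. -/
lemma average_le {c : ℝ} (hc : 0 ≤ c) {f : Fin n → ℝ} (hf : ∀ i, f i ≤ c) :
    (1 / (n : ℝ)) * ∑ i, f i ≤ c := by
  rcases Nat.eq_zero_or_pos n with rfl | hn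
  · simpa using hc
  have hn' : (0 : ℝ) < n := by exact_mod_cast hn
  have h : ∑ i, f i ≤ n * c := by
    simpa using Finset.sum_le_sum fun i (_ : i ∈ Finset.univ) => hf i
  calc (1 / (n : ℝ)) * ∑ i, f i ≤ (1 / (n : ℝ)) * (n * c) := by gcongr
    _ = c := by field_simp

lemma logisticLoss_nonneg (β : Fin p → ℝ) (X : Fin n → Fin p → ℝ) (y : Fin n → ℤˣ) :
    0 ≤ logisticLoss β X y :=
  mul_nonneg (by positivity) (Finset.sum_nonneg fun _ _ => log_one_add_exp_neg_nonneg _)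

lemma logisticLoss_zero_le (X : Fin n → Fin p → ℝ) (y : Fin n → ℤˣ) :
    logisticLoss 0 X y ≤ 1 := by
  refine average_le zero_le_one fun i => ?_
  have : Real.log 2 ≤ 1 := by linarith [Real.log_le_sub_one_of_pos (x := 2) (by norm_num)]
  simpa [one_add_one_eq_two] using this

lemma abs_logisticLoss_sub_le {B : ℝ} {X : Fin n → Fin p → ℝ} (hX : ∀ i j, |X i j| ≤ B)
    (y : Fin n → ℤˣ) (β β' : Fin p → ℝ) :
    |logisticLoss β X y - logisticLoss β' X y| ≤ |B| * ∑ j, |β j - β' j| := by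
  have hnn : 0 ≤ |B| * ∑ j, |β j - β' j| :=
    mul_nonneg (abs_nonneg _) (Finset.sum_nonneg fun _ _ => abs_nonneg _)
  rw [logisticLoss, logisticLoss, ← mul_sub, ← Finset.sum_sub_distrib, abs_mul,
    abs_of_nonneg (by positivity : (0 : ℝ) ≤ 1 / n)]
  refine (mul_le_mul_of_nonneg_left (Finset.abs_sum_le_sum_abs _ _) (by positivity)).trans
    (average_le hnn fun i => (abs_log_one_add_exp_neg_sub_le _ _).trans ?_)
  rw [← mul_sub, abs_mul, abs_label, one_mul, ← dotProduct_sub]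
  exact abs_dotProduct_le (hX i)

lemma logisticLoss_le {B : ℝ} {X : Fin n → Fin p → ℝ} (hX : ∀ i j, |X i j| ≤ B)
    (y : Fin n → ℤˣ) (β : Fin p → ℝ) :
    logisticLoss β X y ≤ 1 + |B| * ∑ j, |β j| := by
  have h1 := abs_logisticLoss_sub_le hX y β 0
  have h2 := logisticLoss_zero_le X y
  simp only [Pi.zero_apply, sub_zero] at h1
  linarith [le_abs_self (logisticLoss β X y - logisticLoss 0 X y)]

lemma logisticLoss_midpoint {M : ℝ} {X : Fin n → Fin p → ℝ} (y : Fin n → ℤˣ)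
    {β β' : Fin p → ℝ} (hβ : ∀ i, |X i ⬝ᵥ β| ≤ M) (hβ' : ∀ i, |X i ⬝ᵥ β'| ≤ M) :
    2 * logisticLoss ((1 / 2 : ℝ) • (β + β')) X y +
        logisticCurvature M * ((1 / (n : ℝ)) * ∑ i, (X i ⬝ᵥ (β - β')) ^ 2) ≤
      logisticLoss β X y + logisticLoss β' X y := by
  have key : ∀ i, 2 * Real.log (1 + Real.exp (-(((y i : ℤ) : ℝ) *
        (X i ⬝ᵥ ((1 / 2 : ℝ) • (β + β')))))) +
        logisticCurvature M * (X i ⬝ᵥ (β - β')) ^ 2 ≤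
      Real.log (1 + Real.exp (-(((y i : ℤ) : ℝ) * (X i ⬝ᵥ β)))) +
        Real.log (1 + Real.exp (-(((y i : ℤ) : ℝ) * (X i ⬝ᵥ β')))) := by
    intro i
    have h := logistic_midpoint (M := M) (a := ((y i : ℤ) : ℝ) * (X i ⬝ᵥ β))
      (b := ((y i : ℤ) : ℝ) * (X i ⬝ᵥ β')) (by rw [abs_mul, abs_label, one_mul]; exact hβ i)
      (by rw [abs_mul, abs_label, one_mul]; exact hβ' i)
    have e1 : ((y i : ℤ) : ℝ) * (X i ⬝ᵥ ((1 / 2 : ℝ) • (β + β'))) =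
        (((y i : ℤ) : ℝ) * (X i ⬝ᵥ β) + ((y i : ℤ) : ℝ) * (X i ⬝ᵥ β')) / 2 := by
      rw [dotProduct_smul, dotProduct_add, smul_eq_mul]; ring
    have e2 : (X i ⬝ᵥ (β - β')) ^ 2 =
        (((y i : ℤ) : ℝ) * (X i ⬝ᵥ β) - ((y i : ℤ) : ℝ) * (X i ⬝ᵥ β')) ^ 2 := by
      rw [← mul_sub, mul_pow, ← sq_abs ((y i : ℤ) : ℝ), abs_label, dotProduct_sub]; ring
    rw [e1, e2]
    exact h
  have hs := Finset.sum_le_sum fun i (_ : i ∈ Finset.univ) => key i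
  rw [Finset.sum_add_distrib, Finset.sum_add_distrib, ← Finset.mul_sum, ← Finset.mul_sum] at hs
  have := mul_le_mul_of_nonneg_left hs (by positivity : (0 : ℝ) ≤ 1 / n)
  unfold logisticLoss
  linarith

/-! ### The penalties -/

/-- A modulus of midpoint strong convexity of the penalty with respect to `‖·‖₂`. -/
noncomputable def Penalty.modulus : Penalty → ℝ
  | .l1 => 0
  | .l2 => 1 / 2

lemma Penalty.modulus_nonneg (pen : Penalty) : 0 ≤ pen.modulus := by
  cases pen <;> simp [Penalty.modulus]

lemma Penalty.value_nonneg (pen : Penalty) (β : Fin p → ℝ) : 0 ≤ pen.value β := by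
  cases pen
  · exact Finset.sum_nonneg fun _ _ => abs_nonneg _
  · exact Finset.sum_nonneg fun _ _ => sq_nonneg _

lemma Penalty.value_zero (pen : Penalty) : pen.value (0 : Fin p → ℝ) = 0 := by
  cases pen <;> simp [Penalty.value]

lemma Penalty.sum_abs_le (pen : Penalty) (β : Fin p → ℝ) :
    ∑ j, |β j| ≤ pen.value β + p := by
  cases pen
  · simp [Penalty.value]
  · have : ∑ j, |β j| ≤ ∑ j, (β j ^ 2 + 1) := Finset.sum_le_sum fun j _ => by
      nlinarith [sq_nonneg (|β j| - 1), sq_abs (β j), abs_nonneg (β j)]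
    simpa [Penalty.value, Finset.sum_add_distrib] using this

lemma Penalty.value_midpoint (pen : Penalty) (β β' : Fin p → ℝ) :
    2 * pen.value ((1 / 2 : ℝ) • (β + β')) + pen.modulus * ∑ j, (β - β') j ^ 2 ≤
      pen.value β + pen.value β' := by
  cases pen
  · simp only [Penalty.value, Penalty.modulus, zero_mul, add_zero, Finset.mul_sum,
      ← Finset.sum_add_distrib]
    refine Finset.sum_le_sum fun j _ => ?_
    simp only [Pi.smul_apply, Pi.add_apply, smul_eq_mul, abs_mul]
    rw [abs_of_pos (by norm_num : (0 : ℝ) < 1 / 2)]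
    linarith [abs_add_le (β j) (β' j)]
  · simp only [Penalty.value, Penalty.modulus, Finset.mul_sum, ← Finset.sum_add_distrib]
    refine Finset.sum_le_sum fun j _ => le_of_eq ?_
    simp only [Pi.smul_apply, Pi.add_apply, Pi.sub_apply, smul_eq_mul]
    ring

lemma Penalty.abs_value_sub_le (pen : Penalty) {r : ℝ} {β β' : Fin p → ℝ}
    (hβ : ∑ j, |β j| ≤ r) (hβ' : ∑ j, |β' j| ≤ r) :
    |pen.value β - pen.value β'| ≤ (1 + 2 * r) * ∑ j, |(β - β') j| := by
  have hr : 0 ≤ r := (Finset.sum_nonneg fun _ _ => abs_nonneg _).trans hβ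
  cases pen
  all_goals
    simp only [Penalty.value, ← Finset.sum_sub_distrib, Finset.mul_sum, Pi.sub_apply]
    refine (Finset.abs_sum_le_sum_abs _ _).trans (Finset.sum_le_sum fun j _ => ?_)
  · nlinarith [abs_abs_sub_abs_le (β j) (β' j), abs_nonneg (β j - β' j)]
  · have h1 : |β j| ≤ r :=
      (Finset.single_le_sum (f := fun j => |β j|) (fun _ _ => abs_nonneg _)
        (Finset.mem_univ j)).trans hβ
    have h2 : |β' j| ≤ r :=
      (Finset.single_le_sum (f := fun j => |β' j|) (fun _ _ => abs_nonneg _)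
        (Finset.mem_univ j)).trans hβ'
    rw [sq_sub_sq, abs_mul]
    refine mul_le_mul_of_nonneg_right ?_ (abs_nonneg _)
    linarith [abs_add_le (β j) (β' j)]

/-! ### Existence, boundedness and uniqueness of the fits -/

variable {pen : Penalty} {X : Fin n → Fin p → ℝ} {y : Fin n → ℤˣ}

lemma objective_zero_le (pen : Penalty) (X : Fin n → Fin p → ℝ) (y : Fin n → ℤˣ) (lam : ℝ) :
    objective pen X y lam 0 ≤ 1 := by
  rw [objective, Penalty.value_zero, mul_zero, add_zero]
  exact logisticLoss_zero_le X y

lemma sum_abs_le_of_objective_le {lamMin lam : ℝ} (h0 : 0 < lamMin) (hlam : lamMin ≤ lam)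
    {β : Fin p → ℝ} (h : objective pen X y lam β ≤ 1) : ∑ j, |β j| ≤ 1 / lamMin + p := by
  have h1 := pen.sum_abs_le β
  have h2 := logisticLoss_nonneg β X y
  have h3 := pen.value_nonneg β
  have h4 : lamMin * pen.value β ≤ 1 := by
    unfold objective at h
    nlinarith
  have h5 : pen.value β ≤ 1 / lamMin := by
    rw [le_div_iff₀ h0]; linarith
  linarith

lemma IsFit.sum_abs_le {lamMin lam : ℝ} (h0 : 0 < lamMin) (hlam : lamMin ≤ lam)
    {β : Fin p → ℝ} (h : IsFit pen X y lam β) : ∑ j, |β j| ≤ 1 / lamMin + p :=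
  sum_abs_le_of_objective_le h0 hlam
    ((h (Set.mem_univ 0)).trans (objective_zero_le pen X y lam))

lemma IsFit.of_penalty_eq {pen' : Penalty} {lam : ℝ} {β : Fin p → ℝ}
    (h : IsFit pen X y lam β) (hpen : pen = pen') : IsFit pen' X y lam β :=
  hpen ▸ h

lemma norm_le_of_sum_abs_le {r : ℝ} {β : Fin p → ℝ} (h : ∑ j, |β j| ≤ r) : ‖β‖ ≤ r := by
  have h0 : 0 ≤ r := (Finset.sum_nonneg fun _ _ => abs_nonneg _).trans h
  refine (pi_norm_le_iff_of_nonneg h0).2 fun j => ?_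
  exact (Finset.single_le_sum (f := fun j => |β j|) (fun _ _ => abs_nonneg _)
    (Finset.mem_univ j)).trans h

lemma continuous_logisticLoss {Z : Type*} [TopologicalSpace Z] {β : Z → Fin p → ℝ}
    {X : Z → Fin n → Fin p → ℝ} {y : Z → Fin n → ℤˣ} (hβ : Continuous β) (hX : Continuous X)
    (hy : Continuous y) : Continuous fun z => logisticLoss (β z) (X z) (y z) := by
  have hy' : ∀ i : Fin n, Continuous fun z => (((y z i : ℤˣ) : ℤ) : ℝ) := fun i =>
    (continuous_of_discreteTopology (f := fun k : ℤ => (k : ℝ))).comp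
      (Units.continuous_val.comp ((continuous_apply i).comp hy))
  have hd : ∀ i : Fin n, Continuous fun z => X z i ⬝ᵥ β z := fun i =>
    continuous_finsetSum _ fun j _ => by fun_prop
  unfold logisticLoss
  refine continuous_const.mul (continuous_finsetSum _ fun i _ => ?_)
  exact (continuous_const.add (Real.continuous_exp.comp ((hy' i).mul (hd i)).neg)).log
    fun z => (add_pos one_pos (Real.exp_pos _)).ne'

lemma Penalty.continuous_value (pen : Penalty) :
    Continuous (pen.value : (Fin p → ℝ) → ℝ) := by
  cases pen
  · exact continuous_finsetSum _ fun j _ => (continuous_apply j).abs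
  · exact continuous_finsetSum _ fun j _ => (continuous_apply j).pow 2

lemma continuous_objective (pen : Penalty) {Z : Type*} [TopologicalSpace Z] {lam : Z → ℝ}
    {β : Z → Fin p → ℝ} {X : Z → Fin n → Fin p → ℝ} {y : Z → Fin n → ℤˣ}
    (hlam : Continuous lam) (hX : Continuous X) (hy : Continuous y) (hβ : Continuous β) :
    Continuous fun z => objective pen (X z) (y z) (lam z) (β z) :=
  (continuous_logisticLoss hβ hX hy).add (hlam.mul (pen.continuous_value.comp hβ))

lemma exists_isFit (pen : Penalty) (X : Fin n → Fin p → ℝ) (y : Fin n → ℤˣ) {lam : ℝ}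
    (hlam : 0 < lam) : ∃ β, IsFit pen X y lam β := by
  have hc : Continuous fun β => objective pen X y lam β :=
    continuous_objective pen continuous_const continuous_const continuous_const continuous_id
  have hr : 0 ≤ 1 / lam + p := by positivity
  obtain ⟨β, -, hβ⟩ := (isCompact_closedBall (0 : Fin p → ℝ) (1 / lam + p)).exists_isMinOn
    ⟨0, by simpa using hr⟩ hc.continuousOn
  refine ⟨β, fun w _ => ?_⟩
  by_cases hw : objective pen X y lam w ≤ 1
  · refine hβ (?_ : w ∈ Metric.closedBall 0 _)
    rw [mem_closedBall_zero_iff]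
    exact norm_le_of_sum_abs_le (sum_abs_le_of_objective_le hlam le_rfl hw)
  · have h0 : objective pen X y lam β ≤ objective pen X y lam 0 :=
      hβ (by simpa using hr : (0 : Fin p → ℝ) ∈ Metric.closedBall 0 _)
    exact h0.trans ((objective_zero_le pen X y lam).trans (le_of_not_ge hw))

lemma isFit_estimator (pen : Penalty) (X : Fin n → Fin p → ℝ) (y : Fin n → ℤˣ) {lam : ℝ}
    (hlam : 0 < lam) : IsFit pen X y lam (estimator pen X y lam) :=
  Classical.epsilon_spec (exists_isFit pen X y hlam)

/-- The modulus of midpoint strong convexity of the training objective with respect to `‖·‖₂`,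
restricted to differences on which the Gram matrix is at least `κ` in the case of the `ℓ1` penalty.
It comes from the loss for the `ℓ1` penalty, and from the penalty itself for the `ℓ2` penalty. -/
noncomputable def fitModulus (pen : Penalty) (p : ℕ) (lamMin B κ : ℝ) : ℝ :=
  match pen with
  | .l1 => logisticCurvature (|B| * (1 / lamMin + p)) * κ
  | .l2 => lamMin / 2

lemma fitModulus_pos (pen : Penalty) (p : ℕ) {lamMin κ : ℝ} (B : ℝ) (h0 : 0 < lamMin)
    (hκ : 0 < κ) : 0 < fitModulus pen p lamMin B κ := by
  cases pen
  · exact mul_pos (logisticCurvature_pos _) hκ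
  · exact half_pos h0

/-- Stability of the fits: the optimality of `β` at `lam` and of `β'` at `lam'`, both tested
against the midpoint of `β` and `β'`, bounds the strong convexity gain. -/
lemma fitModulus_mul_sum_sq_le {lamMin B κ lam lam' : ℝ} (h0 : 0 < lamMin)
    (hX : ∀ i j, |X i j| ≤ B) (hlam : lamMin ≤ lam) (hlam' : lamMin ≤ lam')
    {β β' : Fin p → ℝ} (hβ : IsFit pen X y lam β) (hβ' : IsFit pen X y lam' β')
    (hgram : pen = .l1 → κ * ∑ j, (β - β') j ^ 2 ≤ (1 / (n : ℝ)) * ∑ i, (X i ⬝ᵥ (β - β')) ^ 2) :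
    fitModulus pen p lamMin B κ * ∑ j, (β - β') j ^ 2 ≤
      |lam - lam'| * |pen.value β - pen.value β'| := by
  have hr := hβ.sum_abs_le h0 hlam
  have hr' := hβ'.sum_abs_le h0 hlam'
  have hM : ∀ i, |X i ⬝ᵥ β| ≤ |B| * (1 / lamMin + p) := fun i =>
    (abs_dotProduct_le (hX i)).trans (mul_le_mul_of_nonneg_left hr (abs_nonneg _))
  have hM' : ∀ i, |X i ⬝ᵥ β'| ≤ |B| * (1 / lamMin + p) := fun i =>
    (abs_dotProduct_le (hX i)).trans (mul_le_mul_of_nonneg_left hr' (abs_nonneg _))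
  have hl := logisticLoss_midpoint y hM hM'
  have hp := pen.value_midpoint β β'
  have h1 : objective pen X y lam β ≤ objective pen X y lam ((1 / 2 : ℝ) • (β + β')) :=
    hβ (Set.mem_univ _)
  have h2 : objective pen X y lam' β' ≤ objective pen X y lam' ((1 / 2 : ℝ) • (β + β')) :=
    hβ' (Set.mem_univ _)
  unfold objective at h1 h2
  have h3 : (lam' - lam) * (pen.value β - pen.value β') ≤
      |lam - lam'| * |pen.value β - pen.value β'| := by
    rw [abs_sub_comm lam, ← abs_mul]
    exact le_abs_self _
  have h4 := mul_le_mul_of_nonneg_left hp (by linarith : 0 ≤ (lam + lam') / 2)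
  have hS : 0 ≤ ∑ j, (β - β') j ^ 2 := Finset.sum_nonneg fun _ _ => sq_nonneg _
  have hG : 0 ≤ (1 / (n : ℝ)) * ∑ i, (X i ⬝ᵥ (β - β')) ^ 2 :=
    mul_nonneg (by positivity) (Finset.sum_nonneg fun _ _ => sq_nonneg _)
  have hc := (logisticCurvature_pos (|B| * (1 / lamMin + p))).le
  have h5 : 0 ≤ |lam - lam'| * |pen.value β - pen.value β'| := by positivity
  have h6 : logisticCurvature (|B| * (1 / lamMin + p)) *
        ((1 / (n : ℝ)) * ∑ i, (X i ⬝ᵥ (β - β')) ^ 2) +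
      (lam + lam') / 2 * (pen.modulus * ∑ j, (β - β') j ^ 2) ≤
      |lam - lam'| * |pen.value β - pen.value β'| := by
    linarith
  refine le_trans ?_ h6
  cases pen
  · have := mul_le_mul_of_nonneg_left (hgram rfl) hc
    simp only [fitModulus, Penalty.modulus, zero_mul, mul_zero, add_zero]
    linarith
  · simp only [fitModulus, Penalty.modulus]
    nlinarith [mul_nonneg hc hG]

/-- The Lipschitz constant (in `‖·‖₁`) of the regularization path. -/
noncomputable def pathConstant (pen : Penalty) (p : ℕ) (lamMin B κ : ℝ) : ℝ :=
  p * (1 + 2 * (1 / lamMin + p)) / fitModulus pen p lamMin B κ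

lemma pathConstant_nonneg (pen : Penalty) (p : ℕ) {lamMin κ : ℝ} (B : ℝ) (h0 : 0 < lamMin)
    (hκ : 0 < κ) : 0 ≤ pathConstant pen p lamMin B κ := by
  have := fitModulus_pos pen p B h0 hκ
  unfold pathConstant
  positivity

lemma sum_abs_sub_le_pathConstant {lamMin B κ lam lam' : ℝ} (h0 : 0 < lamMin) (hκ : 0 < κ)
    (hX : ∀ i j, |X i j| ≤ B) (hlam : lamMin ≤ lam) (hlam' : lamMin ≤ lam')
    {β β' : Fin p → ℝ} (hβ : IsFit pen X y lam β) (hβ' : IsFit pen X y lam' β')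
    (hgram : pen = .l1 → κ * ∑ j, (β - β') j ^ 2 ≤ (1 / (n : ℝ)) * ∑ i, (X i ⬝ᵥ (β - β')) ^ 2) :
    ∑ j, |(β - β') j| ≤ pathConstant pen p lamMin B κ * |lam - lam'| := by
  have h1 := fitModulus_mul_sum_sq_le h0 hX hlam hlam' hβ hβ' hgram
  have h2 := pen.abs_value_sub_le (hβ.sum_abs_le h0 hlam) (hβ'.sum_abs_le h0 hlam')
  have hμ := fitModulus_pos pen p B h0 hκ
  -- Cauchy-Schwarz compares `‖·‖₁` with `‖·‖₂`.
  have h3 : (∑ j, |(β - β') j|) ^ 2 ≤ p * ∑ j, (β - β') j ^ 2 := by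
    simpa using sq_sum_le_card_mul_sum_sq (s := Finset.univ) (f := fun j => |(β - β') j|)
  set S := ∑ j, |(β - β') j| with hS
  have hS0 : 0 ≤ S := Finset.sum_nonneg fun _ _ => abs_nonneg _
  have h4 : fitModulus pen p lamMin B κ * S ^ 2 ≤
      p * (1 + 2 * (1 / lamMin + p)) * |lam - lam'| * S := by
    calc fitModulus pen p lamMin B κ * S ^ 2
        ≤ fitModulus pen p lamMin B κ * (p * ∑ j, (β - β') j ^ 2) := by gcongr
      _ = p * (fitModulus pen p lamMin B κ * ∑ j, (β - β') j ^ 2) := by ring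
      _ ≤ p * (|lam - lam'| * ((1 + 2 * (1 / lamMin + p)) * S)) := by
          refine mul_le_mul_of_nonneg_left (h1.trans ?_) (Nat.cast_nonneg p)
          exact mul_le_mul_of_nonneg_left h2 (abs_nonneg _)
      _ = _ := by ring
  rw [pathConstant, div_mul_eq_mul_div, le_div_iff₀ hμ]
  rcases hS0.eq_or_lt with h | h
  · rw [← h]; simp; positivity
  · refine le_of_mul_le_mul_right ?_ h
    linarith

lemma IsFit.midpoint {B lam : ℝ} (hX : ∀ i j, |X i j| ≤ B) (hlam : 0 < lam)
    {β β' : Fin p → ℝ} (hβ : IsFit pen X y lam β) (hβ' : IsFit pen X y lam β') :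
    IsFit pen X y lam ((1 / 2 : ℝ) • (β + β')) := by
  have hM : ∀ i, |X i ⬝ᵥ β| ≤ |B| * (1 / lam + p) := fun i =>
    (abs_dotProduct_le (hX i)).trans
      (mul_le_mul_of_nonneg_left (hβ.sum_abs_le hlam le_rfl) (abs_nonneg _))
  have hM' : ∀ i, |X i ⬝ᵥ β'| ≤ |B| * (1 / lam + p) := fun i =>
    (abs_dotProduct_le (hX i)).trans
      (mul_le_mul_of_nonneg_left (hβ'.sum_abs_le hlam le_rfl) (abs_nonneg _))
  have hl := logisticLoss_midpoint y hM hM'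
  have hp := mul_le_mul_of_nonneg_left (pen.value_midpoint β β') hlam.le
  have hS : 0 ≤ lam * (pen.modulus * ∑ j, (β - β') j ^ 2) :=
    mul_nonneg hlam.le
      (mul_nonneg pen.modulus_nonneg (Finset.sum_nonneg fun _ _ => sq_nonneg _))
  have hG : 0 ≤ logisticCurvature (|B| * (1 / lam + p)) *
      ((1 / (n : ℝ)) * ∑ i, (X i ⬝ᵥ (β - β')) ^ 2) :=
    mul_nonneg (logisticCurvature_pos _).le
      (mul_nonneg (by positivity) (Finset.sum_nonneg fun _ _ => sq_nonneg _))
  intro w hw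
  have h1 : objective pen X y lam β ≤ objective pen X y lam w := hβ hw
  have h2 : objective pen X y lam β' ≤ objective pen X y lam w := hβ' hw
  change objective pen X y lam _ ≤ objective pen X y lam w
  unfold objective at h1 h2 ⊢
  linarith

lemma IsFit.add_pow_smul {B lam : ℝ} (hX : ∀ i j, |X i j| ≤ B) (hlam : 0 < lam)
    {β β' : Fin p → ℝ} (hβ : IsFit pen X y lam β) (hβ' : IsFit pen X y lam β') (k : ℕ) :
    IsFit pen X y lam (β + (1 / 2 : ℝ) ^ k • (β' - β)) := by
  induction k with
  | zero => simpa using hβ'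
  | succ k ih =>
    have h := hβ.midpoint hX hlam ih
    convert h using 1
    ext j
    simp only [Pi.add_apply, Pi.smul_apply, Pi.sub_apply, smul_eq_mul, pow_succ]
    ring

/-- Uniqueness of the fit. For the `ℓ1` penalty, the fits `β + 2⁻ᵏ (β' - β)` with `k` large are
nonzero wherever `β' - β` is, so that the Gram bound applies to `β' - β`. -/
lemma IsFit.unique {lamMin B κ lam : ℝ} {Λ : Set ℝ} (h0 : 0 < lamMin) (hκ : 0 < κ)
    (hX : ∀ i j, |X i j| ≤ B) (hlam : lamMin ≤ lam) (hΛ : lam ∈ Λ)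
    (hgram : pen = .l1 → ActiveGramBound κ Λ X y)
    {β β' : Fin p → ℝ} (hβ : IsFit pen X y lam β) (hβ' : IsFit pen X y lam β') : β = β' := by
  have hg : pen = .l1 →
      κ * ∑ j, (β - β') j ^ 2 ≤ (1 / (n : ℝ)) * ∑ i, (X i ⬝ᵥ (β - β')) ^ 2 := by
    rintro rfl
    have hev : ∀ j, ∀ᶠ k : ℕ in Filter.atTop,
        (β + (1 / 2 : ℝ) ^ k • (β' - β)) j = 0 → (β - β') j = 0 := by
      intro j
      by_cases hj : β j = 0
      · refine Filter.Eventually.of_forall fun k hk => ?_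
        have h2 : ((1 / 2 : ℝ) ^ k) ≠ 0 := by positivity
        simp only [Pi.add_apply, Pi.smul_apply, Pi.sub_apply, smul_eq_mul, hj, zero_add,
          sub_zero, mul_eq_zero, h2, false_or] at hk
        simp [hj, hk]
      · have ht : Filter.Tendsto (fun k : ℕ => (β + (1 / 2 : ℝ) ^ k • (β' - β)) j) Filter.atTop
            (nhds (β j)) := by
          have h := (tendsto_pow_atTop_nhds_zero_of_lt_one (r := (1 / 2 : ℝ)) (by norm_num)
            (by norm_num)).mul_const ((β' - β) j)
          simpa using h.const_add (β j)
        filter_upwards [ht.eventually_ne hj] with k hk hk0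
        exact absurd hk0 hk
    obtain ⟨k, hk⟩ := (Filter.eventually_all.2 hev).exists
    exact hgram rfl lam hΛ _ (hβ.add_pow_smul hX (h0.trans_le hlam) hβ' k) _ hk
  have h := sum_abs_sub_le_pathConstant h0 hκ hX hlam hlam hβ hβ' hg
  rw [sub_self, abs_zero, mul_zero] at h
  ext j
  have hj : |(β - β') j| ≤ 0 :=
    (Finset.single_le_sum (f := fun j => |(β - β') j|) (fun _ _ => abs_nonneg _)
      (Finset.mem_univ j)).trans h
  exact sub_eq_zero.1 (abs_nonpos_iff.1 hj)

/-! ### Continuity and Lipschitz continuity of the validation loss -/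

variable {m m' : ℕ} {lamMin lamMax B κ : ℝ}

/-- If the minimizers of a jointly continuous family of functions are unique and stay in a compact
set, then they depend continuously on the parameter: a cluster point of minimizers is a
minimizer. -/
lemma continuous_of_forall_unique_minimizer {Θ E : Type*} [TopologicalSpace Θ]
    [TopologicalSpace E] {F : Θ → E → ℝ} (hF : Continuous fun z : Θ × E => F z.1 z.2) {K : Set E}
    (hK : IsCompact K) {g : Θ → E} (hgK : ∀ θ, g θ ∈ K) (hmin : ∀ θ w, F θ (g θ) ≤ F θ w)
    (huniq : ∀ θ v, (∀ w, F θ v ≤ F θ w) → v = g θ) : Continuous g := by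
  refine continuous_iff_continuousAt.2 fun θ => ?_
  refine hK.tendsto_nhds_of_unique_mapClusterPt (Filter.Eventually.of_forall hgK)
    fun v _ hv => huniq θ v fun w => ?_
  by_contra hlt
  have hw : Continuous fun z : Θ × E => F z.1 w :=
    hF.comp (continuous_fst.prodMk continuous_const)
  have hev : ∀ᶠ z in nhds (θ, v), F z.1 w < F z.1 z.2 :=
    hw.continuousAt.eventually_lt hF.continuousAt (lt_of_not_ge hlt)
  rw [nhds_prod_eq, Filter.eventually_prod_iff] at hev
  obtain ⟨pU, hU, pV, hV, hUV⟩ := hev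
  obtain ⟨θ', hV', hU'⟩ :=
    ((mapClusterPt_iff_frequently.1 hv {v | pV v} hV).and_eventually hU).exists
  exact (hUV hU' hV').not_ge (hmin θ' w)

lemma continuous_estimator {Θ : Type*} [TopologicalSpace Θ] {Λ : Set ℝ} {lam : Θ → ℝ}
    {X : Θ → Fin m → Fin p → ℝ} {y : Θ → Fin m → ℤˣ} (h0 : 0 < lamMin) (hκ : 0 < κ)
    (hlam : Continuous lam) (hX : Continuous X) (hy : Continuous y)
    (hB : ∀ θ i j, |X θ i j| ≤ B) (hmin : ∀ θ, lamMin ≤ lam θ) (hΛ : ∀ θ, lam θ ∈ Λ)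
    (hgram : ∀ θ, pen = .l1 → ActiveGramBound κ Λ (X θ) (y θ)) :
    Continuous fun θ => estimator pen (X θ) (y θ) (lam θ) := by
  have hfit : ∀ θ, IsFit pen (X θ) (y θ) (lam θ) (estimator pen (X θ) (y θ) (lam θ)) :=
    fun θ => isFit_estimator pen _ _ (h0.trans_le (hmin θ))
  refine continuous_of_forall_unique_minimizer
    (F := fun θ β => objective pen (X θ) (y θ) (lam θ) β)
    (continuous_objective pen (hlam.comp continuous_fst) (hX.comp continuous_fst)
      (hy.comp continuous_fst) continuous_snd)
    (isCompact_closedBall (0 : Fin p → ℝ) (1 / lamMin + p)) (fun θ => ?_)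
    (fun θ w => hfit θ (Set.mem_univ w)) (fun θ β hβ => ?_)
  · rw [mem_closedBall_zero_iff]
    exact norm_le_of_sum_abs_le ((hfit θ).sum_abs_le h0 (hmin θ))
  · exact IsFit.unique h0 hκ (hB θ) (hmin θ) (hΛ θ) (hgram θ) (fun w _ => hβ w) (hfit θ)

lemma continuous_validationLoss (h0 : 0 < lamMin) (hκ : 0 < κ) :
    Continuous fun q : Set.Icc lamMin lamMax ×
        admissible pen m p m' B κ (Set.Icc lamMin lamMax) =>
      validationLoss pen (q.1 : ℝ) q.2.1 := by
  have hl : Continuous fun q : Set.Icc lamMin lamMax ×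
      admissible pen m p m' B κ (Set.Icc lamMin lamMax) => (q.1 : ℝ) := by fun_prop
  have h1 : Continuous fun q : Set.Icc lamMin lamMax ×
      admissible pen m p m' B κ (Set.Icc lamMin lamMax) => q.2.1.1 := by fun_prop
  have h2 : Continuous fun q : Set.Icc lamMin lamMax ×
      admissible pen m p m' B κ (Set.Icc lamMin lamMax) => q.2.1.2.1 := by fun_prop
  have h3 : Continuous fun q : Set.Icc lamMin lamMax ×
      admissible pen m p m' B κ (Set.Icc lamMin lamMax) => q.2.1.2.2.1 := by fun_prop
  have h4 : Continuous fun q : Set.Icc lamMin lamMax ×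
      admissible pen m p m' B κ (Set.Icc lamMin lamMax) => q.2.1.2.2.2 := by fun_prop
  have h := continuous_estimator (pen := pen) h0 hκ hl h1 h2 (fun q => q.2.2.1)
    (fun q => q.1.2.1) (fun q => q.1.2) (fun q => q.2.2.2.2)
  exact continuous_logisticLoss h h3 h4

lemma validationLoss_nonneg (lam : ℝ) (P : Instance m p m') : 0 ≤ validationLoss pen lam P :=
  logisticLoss_nonneg _ _ _

lemma validationLoss_le (h0 : 0 < lamMin) {lam : ℝ} (hlam : lamMin ≤ lam) {Λ : Set ℝ}
    {P : Instance m p m'} (hP : P ∈ admissible pen m p m' B κ Λ) :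
    validationLoss pen lam P ≤ 1 + |B| * (1 / lamMin + p) := by
  refine (logisticLoss_le hP.2.1 _ _).trans ?_
  gcongr
  exact (isFit_estimator pen P.1 P.2.1 (h0.trans_le hlam)).sum_abs_le h0 hlam

/-- A continuous function whose increments to the right are locally at most `K` times the
step is `K`-Lipschitz. -/
lemma abs_sub_le_of_eventually_right {f : ℝ → ℝ} {a b K : ℝ} (hab : a ≤ b)
    (hf : ContinuousOn f (Set.Icc a b))
    (h : ∀ x ∈ Set.Ico a b, ∀ᶠ z in nhdsWithin x (Set.Ioi x), |f z - f x| ≤ K * (z - x)) :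
    |f b - f a| ≤ K * (b - a) := by
  have key : ∀ g : ℝ → ℝ, ContinuousOn g (Set.Icc a b) →
      (∀ x ∈ Set.Ico a b, ∀ᶠ z in nhdsWithin x (Set.Ioi x), g z - g x ≤ K * (z - x)) →
      g b ≤ g a + K * (b - a) := by
    intro g hg hslope
    refine image_le_of_liminf_slope_right_le_deriv_boundary (B := fun x => g a + K * (x - a))
      (B' := fun _ => K) hg (by simp) (by fun_prop) (fun x _ => ?_) (fun x hx r hr => ?_)
      (Set.right_mem_Icc.2 hab)
    · have := (((hasDerivAt_id x).sub_const a).const_mul K).const_add (g a)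
      simpa using this.hasDerivWithinAt
    · refine Filter.Eventually.frequently ?_
      filter_upwards [hslope x hx, self_mem_nhdsWithin] with z hz hxz
      have hpos : 0 < z - x := sub_pos.2 hxz
      rw [slope_def_field]
      exact ((div_le_iff₀ hpos).2 hz).trans_lt hr
  have h1 := key f hf fun x hx => (h x hx).mono fun z hz => (le_abs_self _).trans hz
  have h2 := key (fun x => -f x) hf.neg fun x hx => (h x hx).mono fun z hz => by
    have := (neg_abs_le (f z - f x))
    linarith
  exact abs_le.2 ⟨by linarith, by linarith⟩

/-- Close to a given `x`, the active set of the fit contains that of the fit at `x`, by continuity,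
so that the Gram bound applies to the difference of the two fits. -/
lemma eventually_abs_validationLoss_sub_le (h0 : 0 < lamMin) (hκ : 0 < κ)
    (P : admissible pen m p m' B κ (Set.Icc lamMin lamMax)) {x : ℝ}
    (hxΛ : x ∈ Set.Icc lamMin lamMax) :
    ∀ᶠ z in nhdsWithin x (Set.Icc lamMin lamMax),
      |validationLoss pen z P.1 - validationLoss pen x P.1| ≤
        |B| * pathConstant pen p lamMin B κ * |z - x| := by
  have hest : ContinuousOn (fun x : ℝ => estimator pen P.1.1 P.1.2.1 x)
      (Set.Icc lamMin lamMax) := by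
    rw [continuousOn_iff_continuous_domRestrict]
    exact continuous_estimator h0 hκ continuous_subtype_val continuous_const continuous_const
      (fun _ => P.2.1) (fun x => x.2.1) (fun x => x.2) (fun _ => P.2.2.2)
  have hactive : ∀ᶠ z in nhdsWithin x (Set.Icc lamMin lamMax), ∀ j,
      estimator pen P.1.1 P.1.2.1 z j = 0 → estimator pen P.1.1 P.1.2.1 x j = 0 := by
    refine Filter.eventually_all.2 fun j => ?_
    by_cases hj : estimator pen P.1.1 P.1.2.1 x j = 0
    · exact Filter.Eventually.of_forall fun _ _ => hj
    · have ht : Filter.Tendsto (fun z => estimator pen P.1.1 P.1.2.1 z j)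
          (nhdsWithin x (Set.Icc lamMin lamMax)) (nhds (estimator pen P.1.1 P.1.2.1 x j)) :=
        (tendsto_pi_nhds.1 (hest x hxΛ)) j
      filter_upwards [ht.eventually_ne hj] with z hz hz0
      exact absurd hz0 hz
  filter_upwards [hactive, self_mem_nhdsWithin] with z hz hzΛ
  have hfz := isFit_estimator pen P.1.1 P.1.2.1 (h0.trans_le hzΛ.1)
  have hfx := isFit_estimator pen P.1.1 P.1.2.1 (h0.trans_le hxΛ.1)
  have hd := sum_abs_sub_le_pathConstant h0 hκ P.2.1 hzΛ.1 hxΛ.1 hfz hfx fun hpen =>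
    P.2.2.2 hpen z hzΛ _ (hfz.of_penalty_eq hpen) _ fun j hj => by
      rw [Pi.sub_apply, hj, hz j hj, sub_zero]
  have hl := abs_logisticLoss_sub_le P.2.2.1 P.1.2.2.2 (estimator pen P.1.1 P.1.2.1 z)
    (estimator pen P.1.1 P.1.2.1 x)
  rw [mul_assoc]
  exact hl.trans (mul_le_mul_of_nonneg_left hd (abs_nonneg B))

/-- The validation loss is Lipschitz in the regularization parameter: the local estimates add up
along the interval. -/
lemma abs_validationLoss_sub_le (h0 : 0 < lamMin) (hκ : 0 < κ)
    (P : admissible pen m p m' B κ (Set.Icc lamMin lamMax)) (a b : Set.Icc lamMin lamMax) :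
    |validationLoss pen a P.1 - validationLoss pen b P.1| ≤
      |B| * pathConstant pen p lamMin B κ * |(a : ℝ) - b| := by
  wlog hab : (b : ℝ) ≤ a generalizing a b
  · rw [abs_sub_comm, abs_sub_comm (a : ℝ)]
    exact this b a (le_of_not_ge hab)
  have hpair : Continuous fun x : Set.Icc lamMin lamMax => (x, P) := by fun_prop
  have hval : ContinuousOn (fun x : ℝ => validationLoss pen x P.1) (Set.Icc lamMin lamMax) := by
    have h := (continuous_validationLoss (pen := pen) (m := m) (m' := m') (B := B) h0 hκ).comp hpair
    rw [continuousOn_iff_continuous_domRestrict]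
    exact h
  have hsub : Set.Icc (b : ℝ) a ⊆ Set.Icc lamMin lamMax := Set.Icc_subset_Icc b.2.1 a.2.2
  rw [abs_of_nonneg (sub_nonneg.2 hab)]
  refine abs_sub_le_of_eventually_right (f := fun x => validationLoss pen x P.1) hab
    (hval.mono hsub) fun x hx => ?_
  have hxΛ : x ∈ Set.Icc lamMin lamMax := hsub (Set.Ico_subset_Icc_self hx)
  have hright : nhdsWithin x (Set.Ioi x) ≤ nhdsWithin x (Set.Icc lamMin lamMax) := by
    rw [← nhdsWithin_Ioo_eq_nhdsGT hx.2]
    exact nhdsWithin_mono _ fun z hz => ⟨hxΛ.1.trans hz.1.le, hz.2.le.trans a.2.2⟩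
  filter_upwards [hright (eventually_abs_validationLoss_sub_le h0 hκ P hxΛ), self_mem_nhdsWithin]
    with z hz hxz
  have hpos : 0 < z - x := sub_pos.2 hxz
  rwa [abs_of_pos hpos] at hz

end RegularizedLogisticRegression

namespace OnlineLearning

/-! ### Exponential weights -/

section ExpWeights

variable {ι : Type} [Fintype ι]

/-- The exponential weights distribution `exp (- η L k) / ∑ j, exp (- η L j)` for the cumulative
losses `L`. -/
noncomputable def expWeights (η : ℝ) (L : ι → ℝ) (k : ι) : ℝ :=
  Real.exp (-(η * L k)) / ∑ j, Real.exp (-(η * L j))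

lemma expWeights_nonneg (η : ℝ) (L : ι → ℝ) (k : ι) : 0 ≤ expWeights η L k :=
  div_nonneg (Real.exp_pos _).le (Finset.sum_nonneg fun _ _ => (Real.exp_pos _).le)

lemma sum_exp_pos [Nonempty ι] (f : ι → ℝ) : 0 < ∑ k, Real.exp (f k) :=
  Finset.sum_pos (fun _ _ => Real.exp_pos _) Finset.univ_nonempty

lemma sum_expWeights [Nonempty ι] (η : ℝ) (L : ι → ℝ) : ∑ k, expWeights η L k = 1 := by
  unfold expWeights
  rw [← Finset.sum_div]
  exact div_self (sum_exp_pos _).ne'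

lemma exp_neg_le_of_nonneg {x : ℝ} (hx : 0 ≤ x) : Real.exp (-x) ≤ 1 - x + x ^ 2 / 2 := by
  have h := Real.quadratic_le_exp_of_nonneg hx
  have hpos : 0 < 1 - x + x ^ 2 / 2 := by nlinarith [sq_nonneg (x - 1)]
  rw [Real.exp_neg]
  refine inv_le_of_inv_le₀ hpos (le_trans ?_ h)
  rw [inv_le_iff_one_le_mul₀ hpos]
  nlinarith [sq_nonneg (x ^ 2)]

/-- One step of the potential argument: the log-partition function decreases by `η` times the
expected loss, up to a second order term. -/
lemma log_sum_exp_step [Nonempty ι] {η H : ℝ} (hη : 0 ≤ η) (L ℓ : ι → ℝ) (h0 : ∀ k, 0 ≤ ℓ k)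
    (hH : ∀ k, ℓ k ≤ H) :
    Real.log (∑ k, Real.exp (-(η * (L k + ℓ k)))) ≤
      Real.log (∑ k, Real.exp (-(η * L k))) - η * ∑ k, expWeights η L k * ℓ k +
        η ^ 2 * H ^ 2 / 2 := by
  have hS := sum_exp_pos fun k => -(η * L k)
  have hS' := sum_exp_pos fun k => -(η * (L k + ℓ k))
  have hratio : (∑ k, Real.exp (-(η * (L k + ℓ k)))) / ∑ k, Real.exp (-(η * L k)) =
      ∑ k, expWeights η L k * Real.exp (-(η * ℓ k)) := by
    rw [Finset.sum_div]
    refine Finset.sum_congr rfl fun k _ => ?_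
    rw [expWeights, div_mul_eq_mul_div, ← Real.exp_add]
    congr 2; ring
  have hle : ∑ k, expWeights η L k * Real.exp (-(η * ℓ k)) ≤
      1 - η * ∑ k, expWeights η L k * ℓ k + η ^ 2 * H ^ 2 / 2 := by
    calc ∑ k, expWeights η L k * Real.exp (-(η * ℓ k))
        ≤ ∑ k, expWeights η L k * (1 - η * ℓ k + η ^ 2 * H ^ 2 / 2) := by
          refine Finset.sum_le_sum fun k _ =>
            mul_le_mul_of_nonneg_left ?_ (expWeights_nonneg η L k)
          have h1 := exp_neg_le_of_nonneg (mul_nonneg hη (h0 k))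
          have h2 : ℓ k ^ 2 ≤ H ^ 2 := pow_le_pow_left₀ (h0 k) (hH k) 2
          have h3 := mul_le_mul_of_nonneg_left h2 (sq_nonneg η)
          rw [mul_pow] at h1
          linarith
      _ = (∑ k, expWeights η L k) * (1 + η ^ 2 * H ^ 2 / 2) -
            η * ∑ k, expWeights η L k * ℓ k := by
          rw [Finset.sum_mul, Finset.mul_sum, ← Finset.sum_sub_distrib]
          exact Finset.sum_congr rfl fun k _ => by ring
      _ = _ := by rw [sum_expWeights]; ring
  have hlog := Real.log_le_sub_one_of_pos (div_pos hS' hS)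
  rw [Real.log_div hS'.ne' hS.ne', hratio] at hlog
  linarith

/-- The regret of exponential weights on an individual sequence of losses in `[0, H]`. -/
lemma sum_expWeights_le [Nonempty ι] {η H : ℝ} (hη : 0 < η) (ℓ : ℕ → ι → ℝ)
    (h0 : ∀ t k, 0 ≤ ℓ t k) (hH : ∀ t k, ℓ t k ≤ H) (T : ℕ) (k : ι) :
    ∑ t ∈ Finset.range T,
        ∑ j, expWeights η (fun i => ∑ s ∈ Finset.range t, ℓ s i) j * ℓ t j ≤
      ∑ t ∈ Finset.range T, ℓ t k + Real.log (Fintype.card ι) / η + η * H ^ 2 * T / 2 := by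
  have hpot : Real.log (∑ j, Real.exp (-(η * ∑ s ∈ Finset.range T, ℓ s j))) ≤
      Real.log (Fintype.card ι) -
        η * ∑ t ∈ Finset.range T,
          ∑ j, expWeights η (fun i => ∑ s ∈ Finset.range t, ℓ s i) j * ℓ t j +
        T * (η ^ 2 * H ^ 2 / 2) := by
    induction T with
    | zero => simp
    | succ T ih =>
      have h := log_sum_exp_step hη.le (fun i => ∑ s ∈ Finset.range T, ℓ s i) (ℓ T) (h0 T) (hH T)
      simp only [Finset.sum_range_succ]
      push_cast
      linarith
  have hsingle : -(η * ∑ s ∈ Finset.range T, ℓ s k) ≤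
      Real.log (∑ j, Real.exp (-(η * ∑ s ∈ Finset.range T, ℓ s j))) := by
    rw [Real.le_log_iff_exp_le (sum_exp_pos _)]
    exact Finset.single_le_sum (f := fun j => Real.exp (-(η * ∑ s ∈ Finset.range T, ℓ s j)))
      (fun _ _ => (Real.exp_pos _).le) (Finset.mem_univ k)
  refine le_of_mul_le_mul_left ?_ hη
  have e : η * (∑ t ∈ Finset.range T, ℓ t k + Real.log (Fintype.card ι) / η +
      η * H ^ 2 * T / 2) = η * ∑ t ∈ Finset.range T, ℓ t k + Real.log (Fintype.card ι) +
        T * (η ^ 2 * H ^ 2 / 2) := by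
    field_simp
  rw [e]
  linarith

end ExpWeights

/-! ### The randomized learner and its expected regret -/

/-- The cumulative loss of an action on the instances of a history. -/
def historyLoss {A 𝒳 : Type} (loss : A → 𝒳 → ℝ) {t : ℕ} (z : Fin t → A × 𝒳) (a : A) : ℝ :=
  ∑ s, loss a (z s).2

lemma historyLoss_history {A 𝒳 : Type} {Ω : Type*} (loss : A → 𝒳 → ℝ) (act : ℕ → Ω → A)
    (inst : ℕ → Ω → 𝒳) (t : ℕ) (ω : Ω) (a : A) :
    historyLoss loss (history act inst t ω) a = ∑ s ∈ Finset.range t, loss a (inst s ω) :=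
  (Finset.sum_range fun s => loss a (inst s ω)).symm

section Hedge

variable {A 𝒳 ι : Type} [MeasurableSpace A] [MeasurableSpace 𝒳] [Fintype ι]

/-- The kernel that draws `g k` with probability `q y k`. -/
noncomputable def finiteKernel {Y : Type*} [MeasurableSpace Y] (q : Y → ι → ℝ)
    (hq : ∀ k, Measurable fun y => q y k) (g : ι → A) : Kernel Y A where
  toFun y := ∑ k, ENNReal.ofReal (q y k) • Measure.dirac (g k)
  measurable' := by
    refine Measure.measurable_of_measurable_coe _ fun s _ => ?_
    simp only [Measure.coe_finsetSum, Finset.sum_apply, Measure.smul_apply, smul_eq_mul]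
    exact Finset.measurable_sum _ fun k _ => (hq k).ennreal_ofReal.mul_const _

lemma isMarkovKernel_finiteKernel {Y : Type*} [MeasurableSpace Y] {q : Y → ι → ℝ}
    (hq : ∀ k, Measurable fun y => q y k) (g : ι → A) (h0 : ∀ y k, 0 ≤ q y k)
    (h1 : ∀ y, ∑ k, q y k = 1) : IsMarkovKernel (finiteKernel q hq g) := by
  refine ⟨fun y => ⟨?_⟩⟩
  change (∑ k, ENNReal.ofReal (q y k) • Measure.dirac (g k)) Set.univ = 1
  simp only [Measure.coe_finsetSum, Finset.sum_apply, Measure.smul_apply, smul_eq_mul,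
    measure_univ, mul_one]
  rw [← ENNReal.ofReal_sum_of_nonneg fun k _ => h0 y k, h1, ENNReal.ofReal_one]

lemma integral_finiteKernel {Y : Type*} [MeasurableSpace Y] {q : Y → ι → ℝ}
    (hq : ∀ k, Measurable fun y => q y k) (g : ι → A) (h0 : ∀ y k, 0 ≤ q y k) {f : A → ℝ}
    (hf : Measurable f) (y : Y) :
    ∫ a, f a ∂(finiteKernel q hq g y) = ∑ k, q y k * f (g k) := by
  change ∫ a, f a ∂(∑ k, ENNReal.ofReal (q y k) • Measure.dirac (g k)) = _
  rw [integral_finsetSum_measure fun k _ => ?_]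
  · refine Finset.sum_congr rfl fun k _ => ?_
    rw [integral_smul_measure, integral_dirac' _ _ hf.stronglyMeasurable,
      ENNReal.toReal_ofReal (h0 y k), smul_eq_mul]
  · exact (integrable_dirac' hf.stronglyMeasurable (by simp)).smul_measure ENNReal.ofReal_ne_top

lemma measurable_expWeights_historyLoss {loss : A → 𝒳 → ℝ} (hloss : ∀ a, Measurable (loss a))
    (g : ι → A) (η : ℝ) (t : ℕ) (k : ι) :
    Measurable fun z : Fin t → A × 𝒳 => expWeights η (fun j => historyLoss loss z (g j)) k := by
  have h : ∀ j, Measurable fun z : Fin t → A × 𝒳 => historyLoss loss z (g j) := fun j =>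
    Finset.measurable_sum _ fun s _ =>
      (hloss (g j)).comp (measurable_snd.comp (measurable_pi_apply s))
  have he : ∀ j, Measurable fun z : Fin t → A × 𝒳 =>
      Real.exp (-(η * historyLoss loss z (g j))) := fun j => ((h j).const_mul η).neg.exp
  exact (he k).div (Finset.measurable_sum _ fun j _ => he j)

/-- The learner that draws its action among the `g k` according to exponential weights. -/
noncomputable def hedge [Nonempty ι] (loss : A → 𝒳 → ℝ) (hloss : ∀ a, Measurable (loss a))
    (g : ι → A) (η : ℝ) : Learner A 𝒳 where
  predict t := finiteKernel (fun z k => expWeights η (fun j => historyLoss loss z (g j)) k)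
    (measurable_expWeights_historyLoss hloss g η t) g
  markov _ := isMarkovKernel_finiteKernel _ _ (fun _ _ => expWeights_nonneg _ _ _)
    fun _ => sum_expWeights _ _

lemma measurable_history {Ω : Type*} [MeasurableSpace Ω] {act : ℕ → Ω → A} {inst : ℕ → Ω → 𝒳}
    (hact : ∀ t, Measurable (act t)) (hinst : ∀ t, Measurable (inst t)) (t : ℕ) :
    Measurable (history act inst t) :=
  measurable_pi_lambda _ fun i => (hact i).prodMk (hinst i)

lemma integrable_of_bounded {Ω : Type*} [MeasurableSpace Ω] {μ : Measure Ω} [IsFiniteMeasure μ]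
    {f : Ω → ℝ} {H : ℝ} (hf : Measurable f) (h0 : ∀ ω, 0 ≤ f ω) (hH : ∀ ω, f ω ≤ H) :
    Integrable f μ :=
  Integrable.of_bound hf.aestronglyMeasurable H
    (Filter.Eventually.of_forall fun ω => by rw [Real.norm_of_nonneg (h0 ω)]; exact hH ω)

/-- The expected loss of a round, conditioned on the history and the instance. -/
lemma IsPlay.integral_loss {L : Learner A 𝒳} {T : ℕ} {Ω : Type*} [MeasurableSpace Ω]
    {μ : Measure Ω} [IsProbabilityMeasure μ] {act : ℕ → Ω → A} {inst : ℕ → Ω → 𝒳}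
    (hplay : IsPlay L T μ act inst) {loss : A → 𝒳 → ℝ} {H : ℝ}
    (hloss : Measurable fun q : A × 𝒳 => loss q.1 q.2) (h0 : ∀ a x, 0 ≤ loss a x)
    (hH : ∀ a x, loss a x ≤ H) {t : ℕ} (ht : t < T) :
    ∫ ω, loss (act t ω) (inst t ω) ∂μ =
      ∫ ω, ∫ a, loss a (inst t ω) ∂(L.predict t (history act inst t ω)) ∂μ := by
  have hpair : Measurable fun ω => (history act inst t ω, inst t ω) :=
    (measurable_history hplay.measurable_act hplay.measurable_inst t).prodMk
      (hplay.measurable_inst t)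
  have hf : Measurable fun z : ((Fin t → A × 𝒳) × 𝒳) × A => loss z.2 z.1.2 :=
    hloss.comp (measurable_snd.prodMk (measurable_snd.comp measurable_fst))
  have hmarkov := L.markov t
  have hprob : IsProbabilityMeasure (μ.map fun ω => (history act inst t ω, inst t ω)) :=
    Measure.isProbabilityMeasure_map hpair.aemeasurable
  have e1 : ∫ ω, loss (act t ω) (inst t ω) ∂μ =
      ∫ z, loss z.2 z.1.2
        ∂(μ.map fun ω => ((history act inst t ω, inst t ω), act t ω)) :=
    (integral_map (hpair.prodMk (hplay.measurable_act t)).aemeasurable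
      hf.aestronglyMeasurable).symm
  rw [e1, hplay.law t ht, Measure.integral_compProd (integrable_of_bounded hf (fun _ => h0 _ _)
    fun _ => hH _ _), integral_map hpair.aemeasurable]
  · rfl
  · exact hf.stronglyMeasurable.integral_kernel_prod_right'.aestronglyMeasurable

variable [Nonempty ι] {Ω : Type*} [MeasurableSpace Ω] {μ : Measure Ω} [IsProbabilityMeasure μ]
  {loss : A → 𝒳 → ℝ} {H η : ℝ} {g : ι → A} {T : ℕ} {act : ℕ → Ω → A} {inst : ℕ → Ω → 𝒳}

lemma integral_loss_hedge (hloss : Measurable fun q : A × 𝒳 => loss q.1 q.2)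
    (hloss' : ∀ a, Measurable (loss a)) (h0 : ∀ a x, 0 ≤ loss a x) (hH : ∀ a x, loss a x ≤ H)
    (hplay : IsPlay (hedge loss hloss' g η) T μ act inst) {t : ℕ} (ht : t < T) :
    ∫ ω, loss (act t ω) (inst t ω) ∂μ =
      ∫ ω, ∑ k, expWeights η (fun j => ∑ s ∈ Finset.range t, loss (g j) (inst s ω)) k *
        loss (g k) (inst t ω) ∂μ := by
  rw [hplay.integral_loss hloss h0 hH ht]
  refine integral_congr_ae (Filter.Eventually.of_forall fun ω => ?_)
  simp only [hedge, ← historyLoss_history loss act inst]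
  exact integral_finiteKernel _ g (fun _ _ => expWeights_nonneg _ _ _)
    (hloss.comp (measurable_id.prodMk measurable_const)) _

/-- The expected regret of exponential weights with respect to the actions `g k`, against an
adaptive adversary. -/
lemma expectedRegret_hedge_le (hloss : Measurable fun q : A × 𝒳 => loss q.1 q.2)
    (hloss' : ∀ a, Measurable (loss a)) (h0 : ∀ a x, 0 ≤ loss a x) (hH : ∀ a x, loss a x ≤ H)
    (hη : 0 < η) (hplay : IsPlay (hedge loss hloss' g η) T μ act inst) (k : ι) :
    expectedRegret μ loss T act inst (g k) ≤
      Real.log (Fintype.card ι) / η + η * H ^ 2 * T / 2 := by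
  have hact := hplay.measurable_act
  have hinst := hplay.measurable_inst
  have hi1 : ∀ t, Integrable (fun ω => loss (act t ω) (inst t ω)) μ := fun t =>
    integrable_of_bounded (hloss.comp ((hact t).prodMk (hinst t))) (fun _ => h0 _ _)
      fun _ => hH _ _
  have hi2 : ∀ a t, Integrable (fun ω => loss a (inst t ω)) μ := fun a t =>
    integrable_of_bounded ((hloss' a).comp (hinst t)) (fun _ => h0 _ _) fun _ => hH _ _
  have hi3 : ∀ t, Integrable (fun ω =>
      ∑ k, expWeights η (fun j => ∑ s ∈ Finset.range t, loss (g j) (inst s ω)) k *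
        loss (g k) (inst t ω)) μ := by
    intro t
    refine integrable_of_bounded (H := H) (Finset.measurable_sum _ fun k _ => ?_)
      (fun ω => Finset.sum_nonneg fun k _ => mul_nonneg (expWeights_nonneg _ _ _) (h0 _ _))
      (fun ω => ?_)
    · have h := (measurable_expWeights_historyLoss hloss' g η t k).comp
        (measurable_history hact hinst t)
      simp only [Function.comp_def, historyLoss_history] at h
      exact h.mul ((hloss' (g k)).comp (hinst t))
    · calc _ ≤ ∑ k, expWeights η (fun j => ∑ s ∈ Finset.range t, loss (g j) (inst s ω)) k * H :=
            Finset.sum_le_sum fun k _ =>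
              mul_le_mul_of_nonneg_left (hH _ _) (expWeights_nonneg _ _ _)
        _ = H := by rw [← Finset.sum_mul, sum_expWeights, one_mul]
  have hsum : expectedRegret μ loss T act inst (g k) =
      ∫ ω, (∑ t ∈ Finset.range T,
        ∑ k, expWeights η (fun j => ∑ s ∈ Finset.range t, loss (g j) (inst s ω)) k *
          loss (g k) (inst t ω)) - ∑ t ∈ Finset.range T, loss (g k) (inst t ω) ∂μ := by
    unfold expectedRegret
    have hi4 : ∀ t, Integrable (fun ω => loss (act t ω) (inst t ω) - loss (g k) (inst t ω)) μ :=
      fun t => (hi1 t).sub (hi2 _ t)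
    rw [integral_finsetSum _ fun t _ => hi4 t,
      integral_sub (integrable_finsetSum _ fun t _ => hi3 t)
        (integrable_finsetSum _ fun t _ => hi2 _ t),
      integral_finsetSum _ fun t _ => hi3 t, integral_finsetSum _ fun t _ => hi2 _ t,
      ← Finset.sum_sub_distrib]
    refine Finset.sum_congr rfl fun t ht => ?_
    rw [integral_sub (hi1 t) (hi2 _ t),
      integral_loss_hedge hloss hloss' h0 hH hplay (Finset.mem_range.1 ht)]
  rw [hsum]
  have hle : ∀ ω, (∑ t ∈ Finset.range T,
        ∑ k, expWeights η (fun j => ∑ s ∈ Finset.range t, loss (g j) (inst s ω)) k *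
          loss (g k) (inst t ω)) - ∑ t ∈ Finset.range T, loss (g k) (inst t ω) ≤
      Real.log (Fintype.card ι) / η + η * H ^ 2 * T / 2 := fun ω => by
    have := sum_expWeights_le hη (fun t k => loss (g k) (inst t ω)) (fun _ _ => h0 _ _)
      (fun _ _ => hH _ _) T k
    linarith
  refine (integral_mono ((integrable_finsetSum _ fun t _ => hi3 t).sub
    (integrable_finsetSum _ fun t _ => hi2 _ t)) (integrable_const _) hle).trans ?_
  simp

end Hedge

/-! ### Lipschitz losses on an interval -/

section Lipschitz

/-- The grid of the points `a + k (b - a) / N`, `k ≤ N`, in `[a, b]`. -/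
noncomputable def intervalGrid {a b : ℝ} (hab : a ≤ b) {N : ℕ} (hN : 0 < N) (k : Fin (N + 1)) :
    Set.Icc a b :=
  ⟨a + k * ((b - a) / N), by
    have hN' : (0 : ℝ) < N := by exact_mod_cast hN
    have hk : (k : ℝ) ≤ N := by exact_mod_cast Nat.lt_succ_iff.1 k.2
    have h0 : 0 ≤ (b - a) / N := div_nonneg (sub_nonneg.2 hab) hN'.le
    have h1 : (k : ℝ) * ((b - a) / N) ≤ b - a := by
      calc (k : ℝ) * ((b - a) / N) ≤ N * ((b - a) / N) := by gcongr
        _ = b - a := by field_simp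
    have h2 : 0 ≤ (k : ℝ) * ((b - a) / N) := by positivity
    exact ⟨by linarith, by linarith⟩⟩

lemma exists_abs_intervalGrid_sub_le {a b : ℝ} (hab : a < b) {N : ℕ} (hN : 0 < N)
    (x : Set.Icc a b) : ∃ k, |(intervalGrid hab.le hN k : ℝ) - x| ≤ (b - a) / N := by
  have hN' : (0 : ℝ) < N := by exact_mod_cast hN
  have hd : 0 < (b - a) / N := div_pos (sub_pos.2 hab) hN'
  set r := ((x : ℝ) - a) / ((b - a) / N) with hr
  have hr0 : 0 ≤ r := div_nonneg (sub_nonneg.2 x.2.1) hd.le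
  have hxr : (x : ℝ) = a + r * ((b - a) / N) := by
    rw [hr, div_mul_cancel₀ _ hd.ne']; ring
  have hrN : r ≤ N := by
    rw [hr, div_le_iff₀ hd]
    calc (x : ℝ) - a ≤ b - a := by linarith [x.2.2]
      _ = N * ((b - a) / N) := by field_simp
  have hk : ⌊r⌋₊ < N + 1 := Nat.lt_succ_of_le (Nat.floor_le_of_le hrN)
  refine ⟨⟨⌊r⌋₊, hk⟩, ?_⟩
  have h1 := Nat.floor_le hr0
  have h2 := (Nat.lt_floor_add_one r).le
  have e : (intervalGrid hab.le hN ⟨⌊r⌋₊, hk⟩ : ℝ) - x = -((r - ⌊r⌋₊) * ((b - a) / N)) := by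
    rw [hxr]
    simp only [intervalGrid]
    ring
  rw [e, abs_neg, abs_of_nonneg (mul_nonneg (by linarith) hd.le)]
  exact mul_le_of_le_one_left hd.le (by linarith)

variable {𝒳 : Type} {a b H K : ℝ} {loss : Set.Icc a b → 𝒳 → ℝ}

lemma exists_isMinOn_expectedLoss {Ω : Type*} [MeasurableSpace Ω] {μ : Measure Ω}
    [IsProbabilityMeasure μ] (hab : a ≤ b) (hK : 0 ≤ K)
    (hlip : ∀ x y P, |loss x P - loss y P| ≤ K * |(x : ℝ) - y|) (T : ℕ) (inst : ℕ → Ω → 𝒳)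
    (hint : ∀ x t, Integrable (fun ω => loss x (inst t ω)) μ) :
    ∃ x, IsMinOn (expectedLoss μ loss T inst) Set.univ x := by
  have hle : ∀ x y, expectedLoss μ loss T inst x ≤
      expectedLoss μ loss T inst y + T * K * dist x y := by
    intro x y
    have e : expectedLoss μ loss T inst y + T * K * dist x y =
        ∫ ω, (∑ t ∈ Finset.range T, loss y (inst t ω)) + T * K * dist x y ∂μ := by
      rw [integral_add (integrable_finsetSum _ fun t _ => hint y t) (integrable_const _)]
      simp [expectedLoss]
    rw [e]
    refine integral_mono (integrable_finsetSum _ fun t _ => hint x t)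
      ((integrable_finsetSum _ fun t _ => hint y t).add (integrable_const _)) fun ω => ?_
    have h : ∑ t ∈ Finset.range T, loss x (inst t ω) ≤
        ∑ t ∈ Finset.range T, (loss y (inst t ω) + K * dist x y) :=
      Finset.sum_le_sum fun t _ => by
        have := (le_abs_self _).trans (hlip x y (inst t ω))
        rw [Subtype.dist_eq, Real.dist_eq]
        linarith
    rw [Finset.sum_add_distrib, Finset.sum_const, Finset.card_range, nsmul_eq_mul] at h
    linarith
  have hc : Continuous (expectedLoss μ loss T inst) :=
    (LipschitzWith.of_le_add_mul (Real.toNNReal (T * K)) fun x y => by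
      rw [Real.coe_toNNReal _ (by positivity)]
      exact hle x y).continuous
  have : Nonempty (Set.Icc a b) := ⟨⟨a, le_rfl, hab⟩⟩
  obtain ⟨x, -, hx⟩ := isCompact_univ.exists_isMinOn Set.univ_nonempty hc.continuousOn
  exact ⟨x, hx⟩

/-- Online learning with losses in `[0, H]` that are `K`-Lipschitz in an action from `[a, b]`. The
learner runs exponential weights on a grid of about `(b - a) T` points, so that rounding the best
action to the grid costs at most `K` over all rounds. -/
theorem exists_learner_of_lipschitz [MeasurableSpace 𝒳] (T : ℕ) (hT : 2 ≤ (b - a) * T)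
    (hH0 : 0 < H) (hK : 0 ≤ K)
    (hmeas : Measurable fun q : Set.Icc a b × 𝒳 => loss q.1 q.2) (h0 : ∀ x P, 0 ≤ loss x P)
    (hH : ∀ x P, loss x P ≤ H) (hlip : ∀ x y P, |loss x P - loss y P| ≤ K * |(x : ℝ) - y|) :
    ∃ L : Learner (Set.Icc a b) 𝒳, ∀ {Ω : Type*} [MeasurableSpace Ω] (μ : Measure Ω)
      [IsProbabilityMeasure μ] (act : ℕ → Ω → Set.Icc a b) (inst : ℕ → Ω → 𝒳),
      IsPlay L T μ act inst →
        (∀ t, Integrable (fun ω => loss (act t ω) (inst t ω)) μ) ∧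
        (∀ x t, Integrable (fun ω => loss x (inst t ω)) μ) ∧
        ∃ x, IsMinOn (expectedLoss μ loss T inst) Set.univ x ∧
          expectedRegret μ loss T act inst x ≤
            (5 / 2 * H + 2 * K) * Real.sqrt (T * Real.log ((b - a) * T)) := by
  have hT0 : (0 : ℝ) < T := by
    refine lt_of_le_of_ne (Nat.cast_nonneg T) fun h => ?_
    rw [← h, mul_zero] at hT
    norm_num at hT
  have hT1 : (1 : ℝ) ≤ T := by
    have : 0 < T := by exact_mod_cast hT0
    exact_mod_cast this
  have hab : a < b := by
    by_contra h
    nlinarith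
  set x := (b - a) * (T : ℝ) with hx
  have hN : 0 < ⌈x⌉₊ := Nat.ceil_pos.2 (by linarith)
  have hN' : (0 : ℝ) < ⌈x⌉₊ := by exact_mod_cast hN
  have hlogx : 1 / 4 ≤ Real.log x := by
    have h1 : 1 / 4 ≤ Real.log 2 := by linarith [Real.log_two_gt_d9]
    exact h1.trans (Real.log_le_log (by norm_num) hT)
  set S := Real.sqrt (T * Real.log x) with hS
  have hSsq : S ^ 2 = T * Real.log x := Real.sq_sqrt (mul_nonneg hT0.le (by linarith))
  have hS2 : 1 / 2 ≤ S := by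
    refine Real.le_sqrt_of_sq_le ?_
    nlinarith
  have hS0 : 0 < S := by linarith
  -- `η = √(log x / T) / H` balances the two terms of the regret of exponential weights.
  set η := S / (T * H) with hη
  have hη0 : 0 < η := by positivity
  have hloss : ∀ x, Measurable (loss x) := fun x =>
    hmeas.comp (measurable_const.prodMk measurable_id)
  refine ⟨hedge loss hloss (intervalGrid hab.le hN) η, fun μ _ act inst hplay => ?_⟩
  have hi1 : ∀ t, Integrable (fun ω => loss (act t ω) (inst t ω)) μ := fun t =>
    integrable_of_bounded (hmeas.comp ((hplay.measurable_act t).prodMk (hplay.measurable_inst t)))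
      (fun _ => h0 _ _) fun _ => hH _ _
  have hi2 : ∀ x t, Integrable (fun ω => loss x (inst t ω)) μ := fun x t =>
    integrable_of_bounded ((hloss x).comp (hplay.measurable_inst t)) (fun _ => h0 _ _)
      fun _ => hH _ _
  refine ⟨hi1, hi2, ?_⟩
  obtain ⟨y, hy⟩ := exists_isMinOn_expectedLoss (μ := μ) hab.le hK hlip T inst hi2
  refine ⟨y, hy, ?_⟩
  obtain ⟨k, hk⟩ := exists_abs_intervalGrid_sub_le hab hN y
  have hreg := expectedRegret_hedge_le hmeas hloss h0 hH hη0 hplay k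
  rw [Fintype.card_fin] at hreg
  have hround : expectedRegret μ loss T act inst y ≤
      expectedRegret μ loss T act inst (intervalGrid hab.le hN k) + K := by
    have hi3 : ∀ z, Integrable (fun ω => ∑ t ∈ Finset.range T,
        (loss (act t ω) (inst t ω) - loss z (inst t ω))) μ := fun z =>
      integrable_finsetSum _ fun t _ => (hi1 t).sub (hi2 z t)
    have e : expectedRegret μ loss T act inst (intervalGrid hab.le hN k) + K =
        ∫ ω, (∑ t ∈ Finset.range T, (loss (act t ω) (inst t ω) -
          loss (intervalGrid hab.le hN k) (inst t ω))) + K ∂μ := by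
      rw [integral_add (hi3 _) (integrable_const _)]
      simp [expectedRegret]
    rw [e]
    refine integral_mono (hi3 y) ((hi3 _).add (integrable_const _)) fun ω => ?_
    have hstep : (b - a) / ⌈x⌉₊ ≤ 1 / T := by
      rw [div_le_div_iff₀ hN' hT0, one_mul]
      exact Nat.le_ceil x
    have h : ∑ t ∈ Finset.range T, (loss (act t ω) (inst t ω) - loss y (inst t ω)) ≤
        ∑ t ∈ Finset.range T, ((loss (act t ω) (inst t ω) -
          loss (intervalGrid hab.le hN k) (inst t ω)) + K * (1 / T)) :=
      Finset.sum_le_sum fun t _ => by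
        have h1 := (le_abs_self _).trans (hlip (intervalGrid hab.le hN k) y (inst t ω))
        have h2 := mul_le_mul_of_nonneg_left (hk.trans hstep) hK
        linarith
    rw [Finset.sum_add_distrib, Finset.sum_const, Finset.card_range, nsmul_eq_mul] at h
    have e2 : (T : ℝ) * (K * (1 / T)) = K := by field_simp
    rw [e2] at h
    exact h
  -- `⌈x⌉ + 1 ≤ x + 2 ≤ x²` because `2 ≤ x`.
  have hlogN : Real.log ((⌈x⌉₊ + 1 : ℕ) : ℝ) ≤ 2 * Real.log x := by
    have h1 : ((⌈x⌉₊ + 1 : ℕ) : ℝ) ≤ x ^ 2 := by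
      push_cast
      have := (Nat.ceil_lt_add_one (by linarith : 0 ≤ x)).le
      nlinarith
    calc Real.log ((⌈x⌉₊ + 1 : ℕ) : ℝ) ≤ Real.log (x ^ 2) :=
          Real.log_le_log (by positivity) h1
      _ = 2 * Real.log x := by rw [Real.log_pow]; push_cast; ring
  have e1 : 2 * Real.log x / η = 2 * H * S := by
    have : Real.log x = S ^ 2 / T := by rw [hSsq]; field_simp
    rw [this, hη]
    field_simp
  have e2 : η * H ^ 2 * T / 2 = 1 / 2 * H * S := by
    rw [hη]
    field_simp
  have h3 : Real.log ((⌈x⌉₊ + 1 : ℕ) : ℝ) / η ≤ 2 * H * S := by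
    rw [← e1]
    gcongr
  have h4 : K ≤ 2 * K * S := by nlinarith
  linarith

end Lipschitz

end OnlineLearning

/-! ### Regret of tuning regularized logistic regression -/

/-- Labels carry the discrete measurable structure, so that continuous functions of an instance are
measurable. -/
instance RegularizedLogisticRegression.discreteMeasurableSpace_label :
    DiscreteMeasurableSpace ℤˣ where
  forall_measurableSet s := ⟨(fun u : ℤˣ => (u : ℤ)) '' s, trivial,
    Set.preimage_image_eq s Units.val_injective⟩

instance RegularizedLogisticRegression.opensMeasurableSpace_instance {m p m' : ℕ} :
    OpensMeasurableSpace (RegularizedLogisticRegression.Instance m p m') := by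
  have : SecondCountableTopology ℤˣ := inferInstance
  infer_instance

theorem mainTheorem11 (pen : RegularizedLogisticRegression.Penalty) (p : ℕ)
    (lamMin B κ : ℝ) (hlamMin : 0 < lamMin) (hκ : 0 < κ) :
    ∃ C : ℝ, 0 < C ∧ ∀ (m m' : ℕ) (lamMax : ℝ) (T : ℕ), 2 ≤ (lamMax - lamMin) * (T : ℝ) →
      ∃ L : OnlineLearning.Learner (Set.Icc lamMin lamMax)
          (RegularizedLogisticRegression.admissible pen m p m' B κ (Set.Icc lamMin lamMax)),
        ∀ {Ω : Type*} [MeasurableSpace Ω] (μ : Measure Ω) [IsProbabilityMeasure μ]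
          (lam : ℕ → Ω → Set.Icc lamMin lamMax)
          (P : ℕ → Ω →
            RegularizedLogisticRegression.admissible pen m p m' B κ (Set.Icc lamMin lamMax)),
          OnlineLearning.IsPlay L T μ lam P →
          let h : Set.Icc lamMin lamMax →
              RegularizedLogisticRegression.admissible pen m p m' B κ (Set.Icc lamMin lamMax) → ℝ :=
            fun l Q => RegularizedLogisticRegression.validationLoss pen (l : ℝ) Q.1
          (∀ t < T, Integrable (fun ω => h (lam t ω) (P t ω)) μ) ∧
          (∀ l, ∀ t < T, Integrable (fun ω => h l (P t ω)) μ) ∧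
          ∃ lamStar : Set.Icc lamMin lamMax,
            IsMinOn (OnlineLearning.expectedLoss μ h T P) Set.univ lamStar ∧
            OnlineLearning.expectedRegret μ h T lam P lamStar ≤
              C * Real.sqrt ((T : ℝ) * Real.log ((lamMax - lamMin) * (T : ℝ))) := by
  have hH : 0 < 1 + |B| * (1 / lamMin + p) := by positivity
  have hK : 0 ≤ |B| * RegularizedLogisticRegression.pathConstant pen p lamMin B κ :=
    mul_nonneg (abs_nonneg B)
      (RegularizedLogisticRegression.pathConstant_nonneg pen p B hlamMin hκ)
  refine ⟨5 / 2 * (1 + |B| * (1 / lamMin + p)) +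
    2 * (|B| * RegularizedLogisticRegression.pathConstant pen p lamMin B κ), by linarith,
    fun m m' lamMax T hT => ?_⟩
  obtain ⟨L, hL⟩ := OnlineLearning.exists_learner_of_lipschitz T hT hH hK
    (loss := fun (l : Set.Icc lamMin lamMax) (Q : RegularizedLogisticRegression.admissible
      pen m p m' B κ (Set.Icc lamMin lamMax)) =>
        RegularizedLogisticRegression.validationLoss pen (l : ℝ) Q.1)
    (RegularizedLogisticRegression.continuous_validationLoss hlamMin hκ).measurable
    (fun _ _ => RegularizedLogisticRegression.validationLoss_nonneg _ _)
    (fun l Q => RegularizedLogisticRegression.validationLoss_le hlamMin l.2.1 Q.2)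
    (fun l l' Q => RegularizedLogisticRegression.abs_validationLoss_sub_le hlamMin hκ Q l l')
  refine ⟨L, fun μ _ lam P hplay => ?_⟩
  obtain ⟨h1, h2, h3⟩ := hL μ lam P hplay
  exact ⟨fun t _ => h1 t, fun l t _ => h2 l t, h3⟩
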